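/- Let $p$ be a prime, $m\ge 1$, $d=p^m$, and identify $\mathbf C^d$ with $(\mathbf C^p)^{\otimes m}$. On $\mathbf C^p$ let $X e_k=e_{k+1}$ and $Z e_k=\omega^k e_k$ with $k\in\mathbf Z/p$, $\omega=e^{2\pi i/p}$. Suppose that the $d^2-1$ non-identity tensor products $\bigotimes_{i=1}^m X^{a_i}Z^{b_i}$ ($a,b\in(\mathbf Z/p)^m$, $(a,b)\neq 0$), each multiplied by some complex number of modulus one, are labelled without repetition as $U_{Lj}$ with $L=1,\dots,d+1$, $j=1,\dots,d-1$, in such a way that $U_{Lj}$ and $U_{Lk}$ commute for all $L,j,k$. Put $U_{L0}=I$. For each $L$ let $\{\psi^L_n\}_{n=1}^d$ be an orthonormal basis of $\mathbf C^d$ of simultaneous eigenvectors of the $U_{Lj}$, these $d+1$ bases being mutually unbiased: $|\langle\psi^L_n,\psi^K_k\rangle|^2=1/d$ for $L\ne K$. Let $\Psi_L^{\rm QC}(\rho)=\sum_n\langle\psi^L_n,\rho\,\psi^L_n\rangle\,|\psi^L_n\rangle\langle\psi^L_n|$, and let $\Psi$ be a channel constant on axes, i.e. $$\Psi=s\,\mathcal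 I+\sum_{L=1}^{d+1}t_L\Psi_L^{\rm QC},\qquad s+\sum_L t_L=1,\quad t_L\ge 0,\quad s\ge-\tfrac1{d-1},$$ where $\mathcal I$ is the identity map, with multipliers $\lambda_L=s+t_L$. Suppose that $L_0$ is an axis with $\lambda_{L_0}\ge|\lambda_L|$ for all $L$, and let $$M_J(\rho)=\sum_{j=0}^{d-1}c_j\,U_{Jj}\,\rho\,U_{Jj}^\dagger,\qquad J=L_0,\quad c_j\ge0,\quad\sum_j c_j=1.$$ Suppose that either $\Phi=xM_J+(1-x)\Psi$ for some $0\le x\le1$, or $\Phi=\Psi\circ M_J$. Then for every completely positive trace-preserving linear map $\Omega:M_{d_1}\to M_{d_2}$, $$\nu_2(\Phi\otimes\Omega)=\nu_2(\Phi)\,\nu_2(\Omega),$$ where $\nu_2(\Lambda)=\sup_\gamma\|\Lambda(\gamma)\|_2$, the supremum is over density matrices $\gamma$ (positive semidefinite, trace one), and $\|A\|_2=({\rm Tr}\,A^\dagger A)^{1/2}$. -/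

import Mathlib

open Matrix
open scoped Kronecker ComplexOrder

noncomputable section

/-! ### Channels, tensor products of maps, and the maximal output 2-norm -/

/-- The tensor product `Φ ⊗ Ω` of two linear maps on matrix algebras, acting on matrices indexed
by pairs: a block matrix `ρ = ∑ E_ij ⊗ ρ_ij` is sent to `∑ Φ(E_ij) ⊗ Ω(ρ_ij)`. -/
def tensorMap {n n' a b : Type*} [Fintype n] [DecidableEq n]
    (Φ : Matrix n n ℂ →ₗ[ℂ] Matrix n' n' ℂ) (Ω : Matrix a a ℂ →ₗ[ℂ] Matrix b b ℂ) :
    Matrix (n × a) (n × a) ℂ →ₗ[ℂ] Matrix (n' × b) (n' × b) ℂ where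
  toFun ρ := ∑ i, ∑ j,
    Φ (Matrix.single i j 1) ⊗ₖ Ω (Matrix.of fun k l => ρ (i, k) (j, l))
  map_add' ρ σ := by
    have h : ∀ i j : n, (Matrix.of fun k l => (ρ + σ) (i, k) (j, l)) =
        (Matrix.of fun k l => ρ (i, k) (j, l)) + (Matrix.of fun k l => σ (i, k) (j, l)) :=
      fun i j => rfl
    simp only [h, map_add, Matrix.kronecker_add, Finset.sum_add_distrib]
  map_smul' c ρ := by
    have h : ∀ i j : n, (Matrix.of fun k l => (c • ρ) (i, k) (j, l)) =
        c • (Matrix.of fun k l => ρ (i, k) (j, l)) := fun i j => rfl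
    simp only [h, map_smul, Matrix.kronecker_smul, Finset.smul_sum, RingHom.id_apply]

/-- `(Φ ⊗ Ω)(A ⊗ B) = Φ(A) ⊗ Ω(B)`. -/
theorem tensorMap_kronecker {n n' a b : Type*} [Fintype n] [DecidableEq n]
    (Φ : Matrix n n ℂ →ₗ[ℂ] Matrix n' n' ℂ) (Ω : Matrix a a ℂ →ₗ[ℂ] Matrix b b ℂ)
    (A : Matrix n n ℂ) (B : Matrix a a ℂ) :
    tensorMap Φ Ω (A ⊗ₖ B) = Φ A ⊗ₖ Ω B := by
  have hA : Φ A = ∑ i, ∑ j, A i j • Φ (Matrix.single i j 1) := by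
    conv_lhs => rw [Matrix.matrix_eq_sum_single A]
    simp only [map_sum]
    refine Finset.sum_congr rfl fun i _ => Finset.sum_congr rfl fun j _ => ?_
    rw [← map_smul, Matrix.smul_single, smul_eq_mul, mul_one]
  have hB : tensorMap Φ Ω (A ⊗ₖ B) =
      ∑ i, ∑ j, Φ (Matrix.single i j 1) ⊗ₖ Ω (A i j • B) := rfl
  rw [hB]
  ext x y
  simp only [hA, map_smul, Matrix.sum_apply, Matrix.kroneckerMap_apply, Matrix.smul_apply,
    smul_eq_mul, Finset.sum_mul]
  refine Finset.sum_congr rfl fun i _ => Finset.sum_congr rfl fun j _ => ?_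
  ring

/-- A quantum channel: a completely positive (`Φ ⊗ id_k` preserves positive semidefiniteness
for every `k`) and trace-preserving linear map between matrix algebras. -/
structure IsChannel {n n' : Type*} [Fintype n] [DecidableEq n] [Fintype n']
    (Φ : Matrix n n ℂ →ₗ[ℂ] Matrix n' n' ℂ) : Prop where
  completelyPositive : ∀ (k : ℕ) (A : Matrix (n × Fin k) (n × Fin k) ℂ), A.PosSemidef →
    (tensorMap Φ (LinearMap.id : Matrix (Fin k) (Fin k) ℂ →ₗ[ℂ] _) A).PosSemidef
  tracePreserving : ∀ A : Matrix n n ℂ, (Φ A).trace = A.trace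

/-- A density matrix: positive semidefinite with trace one. -/
def IsDensity {n : Type*} [Fintype n] (γ : Matrix n n ℂ) : Prop :=
  γ.PosSemidef ∧ γ.trace = 1

/-- The Hilbert-Schmidt (Schatten 2-) norm `(Tr A†A)^{1/2}`. -/
def hsNorm {n : Type*} [Fintype n] (A : Matrix n n ℂ) : ℝ :=
  Real.sqrt (Aᴴ * A).trace.re

/-- The maximal output 2-norm `ν₂(Φ) = sup_γ ‖Φ(γ)‖₂`, over density matrices `γ`. -/
def nu2 {n n' : Type*} [Fintype n] [Fintype n'] (Φ : Matrix n n ℂ →ₗ[ℂ] Matrix n' n' ℂ) : ℝ :=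
  ⨆ γ : {γ : Matrix n n ℂ // IsDensity γ}, hsNorm (Φ γ.1)

/-! ### Mutually unbiased bases and channels constant on axes -/

/-- A full set of `d + 1` orthonormal bases that are pairwise mutually unbiased. -/
def IsMUB {d : ℕ} {n : Type*} [Fintype n]
    (ψ : Fin (d + 1) → OrthonormalBasis (Fin d) ℂ (EuclideanSpace ℂ n)) : Prop :=
  ∀ J K, J ≠ K → ∀ k l, ‖inner ℂ (ψ J k) (ψ K l)‖ ^ 2 = 1 / (d : ℝ)

/-- The quantum-classical channel `ρ ↦ ∑_k ⟨ψ_k, ρ ψ_k⟩ |ψ_k⟩⟨ψ_k|` of an orthonormal basis. -/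
def qcChannel {ι n : Type*} [Fintype ι] [Fintype n]
    (ψ : OrthonormalBasis ι ℂ (EuclideanSpace ℂ n)) : Matrix n n ℂ →ₗ[ℂ] Matrix n n ℂ where
  toFun ρ := ∑ k, (star (ψ k).ofLp ⬝ᵥ (ρ *ᵥ (ψ k).ofLp)) •
    vecMulVec (ψ k).ofLp (star (ψ k).ofLp)
  map_add' ρ σ := by
    simp only [Matrix.add_mulVec, dotProduct_add, add_smul, Finset.sum_add_distrib]
  map_smul' c ρ := by
    simp only [Matrix.smul_mulVec, dotProduct_smul, smul_eq_mul, mul_smul, Finset.smul_sum,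
      RingHom.id_apply]

/-- `Ψ` is a channel constant on the axes given by the mutually unbiased bases `ψ`, with
multipliers `lam`: `Ψ = s·id + ∑_L t_L Ψ_L^QC` where `s + ∑_L t_L = 1`, `t_L ≥ 0`,
`s ≥ -1/(d-1)`, and `lam L = s + t_L`. -/
def IsConstantOnAxes {d : ℕ} {n : Type*} [Fintype n]
    (ψ : Fin (d + 1) → OrthonormalBasis (Fin d) ℂ (EuclideanSpace ℂ n))
    (Ψ : Matrix n n ℂ →ₗ[ℂ] Matrix n n ℂ) (lam : Fin (d + 1) → ℝ) : Prop :=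
  IsMUB ψ ∧ ∃ (s : ℝ) (t : Fin (d + 1) → ℝ),
    s + ∑ L, t L = 1 ∧ (∀ L, 0 ≤ t L) ∧ -1 / ((d : ℝ) - 1) ≤ s ∧
    Ψ = (s : ℂ) • LinearMap.id + ∑ L, (t L : ℂ) • qcChannel (ψ L) ∧
    ∀ L, lam L = s + t L

/-! ### Tensor products of generalized Pauli matrices -/

/-- The shift `X e_k = e_{k+1}` on `ℂ^p`, indices mod `p`. -/
def pauliX (p : ℕ) : Matrix (ZMod p) (ZMod p) ℂ :=
  Matrix.of fun i k => if i = k + 1 then 1 else 0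

/-- The clock matrix `Z e_k = ω^k e_k` on `ℂ^p`, with `ω = exp(2πi/p)`. -/
def pauliZ (p : ℕ) : Matrix (ZMod p) (ZMod p) ℂ :=
  Matrix.diagonal fun k => Complex.exp (2 * Real.pi * Complex.I / p) ^ k.val

/-- The tensor product `⨂_i X^{a_i} Z^{b_i}` on `(ℂ^p)^{⊗m} = ℂ^{p^m}`; the standard basis of the
tensor power is indexed by functions `Fin m → ZMod p`. -/
def pauliTensor {p m : ℕ} [NeZero p] (v : (Fin m → ZMod p) × (Fin m → ZMod p)) :
    Matrix (Fin m → ZMod p) (Fin m → ZMod p) ℂ :=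
  Matrix.of fun r c =>
    ∏ i, (pauliX p ^ (v.1 i).val * pauliZ p ^ (v.2 i).val) (r i) (c i)

/-- The matrices `U L j` (with `d = p^m`, `L` one of `d + 1` axes and `j` one of `d - 1` labels)
are, up to unimodular phases, exactly the `d² - 1` non-identity tensor products of generalized
Pauli matrices, each occurring once, and those on a common axis commute. -/
structure IsPauliPartition {p m : ℕ} [NeZero p]
    (U : Fin (p ^ m + 1) → Fin (p ^ m - 1) → Matrix (Fin m → ZMod p) (Fin m → ZMod p) ℂ) :
    Prop where
  exists_labels :
    ∃ e : Fin (p ^ m + 1) × Fin (p ^ m - 1) ≃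
        {v : (Fin m → ZMod p) × (Fin m → ZMod p) // v ≠ 0},
      ∀ L j, ∃ z : ℂ, ‖z‖ = 1 ∧ U L j = z • pauliTensor (e (L, j)).1
  commute : ∀ L j k, Commute (U L j) (U L k)

/-- For every axis `L`, the basis `ψ L` consists of simultaneous eigenvectors of all `U L j`. -/
def IsSimultaneousEigenbases {d : ℕ} {κ n : Type*} [Fintype n]
    (U : Fin (d + 1) → κ → Matrix n n ℂ)
    (ψ : Fin (d + 1) → OrthonormalBasis (Fin d) ℂ (EuclideanSpace ℂ n)) : Prop :=
  ∀ L j k, ∃ μ : ℂ, U L j *ᵥ (ψ L k).ofLp = μ • (ψ L k).ofLp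

/-! ### Conjugations on a single axis -/

/-- Conjugation `ρ ↦ V ρ V†`. -/
def conjMap {n : Type*} [Fintype n] (V : Matrix n n ℂ) : Matrix n n ℂ →ₗ[ℂ] Matrix n n ℂ where
  toFun ρ := V * ρ * Vᴴ
  map_add' ρ σ := by simp only [Matrix.mul_add, Matrix.add_mul]
  map_smul' c ρ := by simp only [Matrix.mul_smul, Matrix.smul_mul, RingHom.id_apply]

/-- `M` is a convex combination of conjugations by the elements `V j` of one axis, the identity
(the element with label `0` of every axis, weight `c₀`) being allowed. -/
def IsAxisConjugation {κ n : Type*} [Fintype κ] [Fintype n]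
    (V : κ → Matrix n n ℂ) (M : Matrix n n ℂ →ₗ[ℂ] Matrix n n ℂ) : Prop :=
  ∃ (c₀ : ℝ) (c : κ → ℝ), 0 ≤ c₀ ∧ (∀ j, 0 ≤ c j) ∧ c₀ + ∑ j, c j = 1 ∧
    M = (c₀ : ℂ) • LinearMap.id + ∑ j, (c j : ℂ) • conjMap (V j)

end

/-! Write `d` for the dimension. On traceless matrices the channel contracts the Hilbert-Schmidt
norm by some `μ`, and on one pure state `P` it acts exactly as `P ↦ μP + (1-μ)I/d`. Being unital and
trace preserving, it then satisfies `‖Φ A‖² ≤ μ²‖A‖² + (1-μ²)|Tr A|²/d` for every `A`, with equality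
at `P`; hence `ν₂(Φ)² = μ² + (1-μ²)/d`.

Multiplicativity follows from this quadratic bound (`nu2_tensorMap_of_norm_sq_le`). Apply it to each
`Y k l`, the matrix of `(k, l)` entries of `Ω` of the blocks of `ρ`, and sum. The norms of the `Y k
l` sum in square to `‖(id ⊗ Ω)ρ‖²`, the traces to `‖Ω(Tr₁ ρ)‖²`. Both are at most `ν₂(Ω)²`, the
first because a positive block matrix is dominated by its diagonal blocks. Product states give the
reverse inequality.

For the contraction, completeness of the bases (`IsMUB.sum_qcChannel`) splits a traceless matrix
into orthogonal axis components, which `Ψ` scales by `λ_L`. The map `M` is a contraction fixing the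
projections of axis `L₀`. So `μ = x + (1-x)λ_{L₀}` for the mixture and `μ = λ_{L₀}` for the
composition. -/

/-! ### Hilbert-Schmidt norm inequalities for positive block matrices. -/

section FrobeniusNorm

open scoped Matrix.Norms.Frobenius

theorem frobenius_norm_sq {l n : Type*} [Fintype l] [Fintype n] (A : Matrix l n ℂ) :
    ‖A‖ ^ 2 = ∑ i, ∑ j, ‖A i j‖ ^ 2 := by
  have h : 0 ≤ ∑ i, ∑ j, ‖A i j‖ ^ 2 :=
    Finset.sum_nonneg fun i _ => Finset.sum_nonneg fun j _ => sq_nonneg _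
  rw [frobenius_norm_def]
  simp only [Real.rpow_two]
  rw [← Real.sqrt_eq_rpow, Real.sq_sqrt h]

theorem trace_conjTranspose_mul_self_re {l n : Type*} [Fintype l] [Fintype n]
    (A : Matrix l n ℂ) : (Aᴴ * A).trace = ((‖A‖ ^ 2 : ℝ) : ℂ) := by
  rw [frobenius_norm_sq, Finset.sum_comm]
  simp [Matrix.trace, Matrix.mul_apply, Complex.conj_mul']

theorem hsNorm_eq_frobenius_norm {n : Type*} [Fintype n] (A : Matrix n n ℂ) :
    hsNorm A = ‖A‖ := by
  rw [hsNorm, trace_conjTranspose_mul_self_re, Complex.ofReal_re, Real.sqrt_sq (norm_nonneg _)]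

theorem norm_trace_conjTranspose_mul_le {l n : Type*} [Fintype l] [Fintype n]
    (A B : Matrix l n ℂ) : ‖(Aᴴ * B).trace‖ ≤ ‖A‖ * ‖B‖ := by
  have h1 : ‖(Aᴴ * B).trace‖ ≤ ∑ x : n × l, ‖A x.2 x.1‖ * ‖B x.2 x.1‖ := by
    rw [Fintype.sum_prod_type]
    simp only [Matrix.trace, Matrix.diag, Matrix.mul_apply, conjTranspose_apply]
    refine (norm_sum_le _ _).trans (Finset.sum_le_sum fun i _ => ?_)
    refine (norm_sum_le _ _).trans (Finset.sum_le_sum fun j _ => ?_)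
    simp
  have h2 : ∀ C : Matrix l n ℂ, √(∑ x : n × l, ‖C x.2 x.1‖ ^ 2) = ‖C‖ := fun C => by
    have h3 : ∑ x : n × l, ‖C x.2 x.1‖ ^ 2 = ‖C‖ ^ 2 := by
      rw [frobenius_norm_sq, Finset.sum_comm, Fintype.sum_prod_type]
    rw [h3, Real.sqrt_sq (norm_nonneg _)]
  refine h1.trans ((Real.sum_mul_le_sqrt_mul_sqrt _ _ _).trans_eq ?_)
  rw [h2 A, h2 B]

theorem frobenius_norm_mul_conjTranspose_self {l n : Type*} [Fintype l] [Fintype n]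
    (A : Matrix l n ℂ) : ‖A * Aᴴ‖ = ‖Aᴴ * A‖ := by
  have h : ((‖A * Aᴴ‖ ^ 2 : ℝ) : ℂ) = ((‖Aᴴ * A‖ ^ 2 : ℝ) : ℂ) := by
    rw [← trace_conjTranspose_mul_self_re, ← trace_conjTranspose_mul_self_re]
    simp only [conjTranspose_mul, conjTranspose_conjTranspose]
    rw [Matrix.mul_assoc, Matrix.trace_mul_comm]
    simp only [Matrix.mul_assoc]
  exact (sq_eq_sq₀ (norm_nonneg _) (norm_nonneg _)).1 (Complex.ofReal_injective h)

/-- Cyclicity turns `‖X†Y‖²` into the inner product of `XX†` and `YY†`; Cauchy-Schwarz and `‖XX†‖ =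
‖X†X‖` finish. -/
theorem frobenius_norm_conjTranspose_mul_sq_le {k l n : Type*} [Fintype k] [Fintype l]
    [Fintype n] (X : Matrix k l ℂ) (Y : Matrix k n ℂ) :
    ‖Xᴴ * Y‖ ^ 2 ≤ ‖Xᴴ * X‖ * ‖Yᴴ * Y‖ := by
  have h : ((Xᴴ * Y)ᴴ * (Xᴴ * Y)).trace = ((X * Xᴴ)ᴴ * (Y * Yᴴ)).trace := by
    simp only [conjTranspose_mul, conjTranspose_conjTranspose]
    rw [Matrix.mul_assoc, Matrix.trace_mul_comm]
    simp only [Matrix.mul_assoc]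
  have h2 := norm_trace_conjTranspose_mul_le (X * Xᴴ) (Y * Yᴴ)
  rw [← h, trace_conjTranspose_mul_self_re, Complex.norm_real, Real.norm_eq_abs,
    abs_of_nonneg (sq_nonneg _), frobenius_norm_mul_conjTranspose_self,
    frobenius_norm_mul_conjTranspose_self] at h2
  exact h2

/-- For a positive semidefinite block matrix, the Frobenius norm is at most the sum of the norms
of the diagonal blocks. -/
theorem Matrix.PosSemidef.frobenius_norm_le_sum_blocks {n b : Type*} [Fintype n] [Fintype b]
    {P : Matrix (n × b) (n × b) ℂ} (hP : P.PosSemidef) :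
    ‖P‖ ≤ ∑ i, ‖Matrix.of fun k l => P (i, k) (i, l)‖ := by
  classical
  obtain ⟨R, hR⟩ : ∃ R : Matrix (n × b) (n × b) ℂ, P = Rᴴ * R := by
    open scoped MatrixOrder Matrix.Norms.L2Operator in
    exact CStarAlgebra.nonneg_iff_eq_star_mul_self.mp hP.nonneg
  -- The block columns of `R`: block `(i, j)` of `P` is `X i† X j`, so its squared norm is at most
  -- the product of the norms of diagonal blocks `i` and `j`.
  let X : n → Matrix (n × b) b ℂ := fun i => R.submatrix id (Prod.mk i)
  have hX : ∀ i j, (Matrix.of fun k l => P (i, k) (j, l)) = (X i)ᴴ * X j := fun i j => by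
    ext k l
    simp [hR, X, Matrix.mul_apply]
  have hsum : ‖P‖ ^ 2 = ∑ i, ∑ j, ‖Matrix.of fun k l => P (i, k) (j, l)‖ ^ 2 := by
    simp only [frobenius_norm_sq, Fintype.sum_prod_type, of_apply]
    exact Finset.sum_congr rfl fun i _ => Finset.sum_comm
  refine le_of_sq_le_sq ?_ (Finset.sum_nonneg fun i _ => norm_nonneg _)
  rw [hsum, sq, Finset.sum_mul_sum]
  refine Finset.sum_le_sum fun i _ => Finset.sum_le_sum fun j _ => ?_
  rw [hX, hX, hX]
  exact frobenius_norm_conjTranspose_mul_sq_le _ _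

/-- The Frobenius norm of a positive semidefinite matrix is at most its trace. -/
theorem Matrix.PosSemidef.frobenius_norm_le_trace {n : Type*} [Fintype n]
    {P : Matrix n n ℂ} (hP : P.PosSemidef) : ‖P‖ ≤ P.trace.re := by
  -- View `P` as a block matrix with 1×1 blocks.
  have h := (hP.submatrix (Prod.fst : n × Unit → n)).frobenius_norm_le_sum_blocks
  have h1 : ‖P.submatrix (Prod.fst : n × Unit → n) (Prod.fst : n × Unit → n)‖ = ‖P‖ := by
    refine (sq_eq_sq₀ (norm_nonneg _) (norm_nonneg _)).1 ?_
    simp only [frobenius_norm_sq, Fintype.sum_prod_type]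
    simp
  rw [h1] at h
  refine h.trans_eq ?_
  rw [Matrix.trace, Complex.re_sum]
  refine Finset.sum_congr rfl fun i _ => ?_
  have h0 : 0 ≤ P i i := hP.diag_nonneg
  have h2 : ‖Matrix.of fun k l : Unit => P.submatrix Prod.fst Prod.fst (i, k) (i, l)‖ =
      ‖P i i‖ := by
    refine (sq_eq_sq₀ (norm_nonneg _) (norm_nonneg _)).1 ?_
    simp [frobenius_norm_sq]
  rw [h2, diag_apply, Complex.re_eq_norm.2 h0]

end FrobeniusNorm

/-! ### Multiplicativity from a quadratic norm bound. -/

section Multiplicativity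

open scoped Matrix.Norms.Frobenius

theorem sum_sum_sum_sum_comm {n a b c : Type*} [Fintype n] [Fintype a] [Fintype b] [Fintype c]
    (f : n → b → a → c → ℝ) :
    ∑ i, ∑ k, ∑ j, ∑ l, f i k j l = ∑ k, ∑ l, ∑ i, ∑ j, f i k j l := by
  rw [Finset.sum_comm]
  refine Finset.sum_congr rfl fun k _ => ?_
  rw [Finset.sum_comm (s := (Finset.univ : Finset c))]
  exact Finset.sum_congr rfl fun i _ => Finset.sum_comm

/-- This is `Φ ⊗ Ω = (Φ ⊗ id)(id ⊗ Ω)`, read entrywise with the output indices of `Ω` held fixed. -/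
theorem tensorMap_apply {n n' a b : Type*} [Fintype n] [DecidableEq n]
    (Φ : Matrix n n ℂ →ₗ[ℂ] Matrix n' n' ℂ) (Ω : Matrix a a ℂ →ₗ[ℂ] Matrix b b ℂ)
    (ρ : Matrix (n × a) (n × a) ℂ) (i j : n') (k l : b) :
    tensorMap Φ Ω ρ (i, k) (j, l) =
      Φ (Matrix.of fun i' j' => Ω (Matrix.of fun k' l' => ρ (i', k') (j', l')) k l) i j := by
  set Y : Matrix n n ℂ :=
    Matrix.of fun i' j' => Ω (Matrix.of fun k' l' => ρ (i', k') (j', l')) k l with hY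
  have h : Φ Y = ∑ i', ∑ j', Y i' j' • Φ (Matrix.single i' j' 1) := by
    conv_lhs => rw [Matrix.matrix_eq_sum_single Y]
    simp only [map_sum]
    refine Finset.sum_congr rfl fun i _ => Finset.sum_congr rfl fun j _ => ?_
    rw [← map_smul, Matrix.smul_single, smul_eq_mul, mul_one]
  rw [h]
  simp only [tensorMap, LinearMap.coe_mk, AddHom.coe_mk, Matrix.sum_apply, kroneckerMap_apply,
    Matrix.smul_apply, smul_eq_mul, hY, of_apply]
  exact Finset.sum_congr rfl fun i _ => Finset.sum_congr rfl fun j _ => mul_comm _ _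

theorem nu2_nonneg {a b : Type*} [Fintype a] [Fintype b] (Φ : Matrix a a ℂ →ₗ[ℂ] Matrix b b ℂ) :
    0 ≤ nu2 Φ :=
  Real.iSup_nonneg fun _ => Real.sqrt_nonneg _

variable {n n' a b : Type*} [Fintype n] [Fintype a] [Fintype b] [DecidableEq a]
  {Ω : Matrix a a ℂ →ₗ[ℂ] Matrix b b ℂ}

/-- A channel applied to every block of a positive semidefinite block matrix yields a positive
semidefinite block matrix. -/
theorem IsChannel.posSemidef_blocks (hΩ : IsChannel Ω) {ρ : Matrix (n × a) (n × a) ℂ}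
    (hρ : ρ.PosSemidef) :
    (Matrix.of fun x y : n × b =>
      Ω (Matrix.of fun k l => ρ (x.1, k) (y.1, l)) x.2 y.2).PosSemidef := by
  -- Complete positivity is stated with a `Fin k` ancilla on the right, hence the relabelling and
  -- the swap of factors.
  let e := Fintype.equivFin n
  have h := hΩ.completelyPositive _ (ρ.submatrix (fun x => (e.symm x.2, x.1))
    (fun x => (e.symm x.2, x.1))) (hρ.submatrix _)
  convert h.submatrix (fun x : n × b => (x.2, e x.1)) using 1
  ext x y
  rw [submatrix_apply, tensorMap_apply, of_apply]
  simp

theorem IsChannel.posSemidef (hΩ : IsChannel Ω) {γ : Matrix a a ℂ} (hγ : γ.PosSemidef) :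
    (Ω γ).PosSemidef :=
  (hΩ.posSemidef_blocks (hγ.submatrix (Prod.snd : Unit × a → a))).submatrix
    (fun k : b => ((), k))

theorem IsChannel.norm_le_trace (hΩ : IsChannel Ω) {γ : Matrix a a ℂ} (hγ : γ.PosSemidef) :
    ‖Ω γ‖ ≤ γ.trace.re := by
  rw [← hΩ.tracePreserving]
  exact (hΩ.posSemidef hγ).frobenius_norm_le_trace

/-- Needed because a real `⨆` over an unbounded family is 0 by convention. -/
theorem IsChannel.bddAbove (hΩ : IsChannel Ω) :
    BddAbove (Set.range fun γ : {γ : Matrix a a ℂ // IsDensity γ} => hsNorm (Ω γ.1)) := by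
  refine ⟨1, ?_⟩
  rintro _ ⟨γ, rfl⟩
  simpa [hsNorm_eq_frobenius_norm, γ.2.2] using hΩ.norm_le_trace γ.2.1

theorem IsChannel.norm_le_nu2_mul_trace (hΩ : IsChannel Ω) {γ : Matrix a a ℂ}
    (hγ : γ.PosSemidef) : ‖Ω γ‖ ≤ nu2 Ω * γ.trace.re := by
  have h0 : 0 ≤ γ.trace := hγ.trace_nonneg
  obtain ⟨t, ht⟩ : ∃ t : ℝ, γ.trace = t := ⟨γ.trace.re, Complex.eq_re_of_ofReal_le h0⟩
  have ht0 : 0 ≤ t := by rw [ht] at h0; exact_mod_cast h0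
  -- A trace-zero `γ` cannot be normalised, but then the trace bound already forces `Ω γ = 0`.
  rcases ht0.eq_or_lt with h | h
  · have := hΩ.norm_le_trace hγ
    simpa [ht, ← h] using this
  · have hd : IsDensity (((t⁻¹ : ℝ) : ℂ) • γ) := by
      refine ⟨hγ.smul (by exact_mod_cast inv_nonneg.2 ht0), ?_⟩
      rw [trace_smul, ht, smul_eq_mul]
      push_cast
      exact inv_mul_cancel₀ (by exact_mod_cast h.ne')
    have h1 := le_ciSup hΩ.bddAbove ⟨_, hd⟩
    change hsNorm (Ω (((t⁻¹ : ℝ) : ℂ) • γ)) ≤ nu2 Ω at h1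
    rw [hsNorm_eq_frobenius_norm, map_smul, norm_smul, Complex.norm_real, Real.norm_eq_abs,
      abs_of_nonneg (inv_nonneg.2 ht0), inv_mul_le_iff₀ h] at h1
    simpa [ht, mul_comm] using h1

/-- An ancilla does not raise `ν₂`: each diagonal block has norm at most `ν₂(Ω)` times its trace
before `Ω`, and these traces sum to one. -/
theorem IsChannel.norm_blocks_le_nu2 (hΩ : IsChannel Ω) {ρ : Matrix (n × a) (n × a) ℂ}
    (hρ : IsDensity ρ) :
    ‖Matrix.of fun x y : n × b => Ω (Matrix.of fun k l => ρ (x.1, k) (y.1, l)) x.2 y.2‖ ≤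
      nu2 Ω := by
  have htr : ∑ i, (Matrix.of fun k l => ρ (i, k) (i, l) : Matrix a a ℂ).trace.re = 1 := by
    have := congrArg Complex.re hρ.2
    simpa [Matrix.trace, Fintype.sum_prod_type] using this
  refine (hΩ.posSemidef_blocks hρ.1).frobenius_norm_le_sum_blocks.trans ?_
  calc _ ≤ ∑ i, nu2 Ω * (Matrix.of fun k l => ρ (i, k) (i, l) : Matrix a a ℂ).trace.re :=
        Finset.sum_le_sum fun i _ =>
          hΩ.norm_le_nu2_mul_trace (hρ.1.submatrix (fun k : a => (i, k)))
    _ = nu2 Ω := by rw [← Finset.mul_sum, htr, mul_one]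

theorem frobenius_norm_kronecker {l m : Type*} [Fintype l] [Fintype m]
    (A : Matrix l l ℂ) (B : Matrix m m ℂ) : ‖A ⊗ₖ B‖ = ‖A‖ * ‖B‖ := by
  refine (sq_eq_sq₀ (norm_nonneg _) (by positivity)).1 ?_
  rw [mul_pow]
  simp only [frobenius_norm_sq, Fintype.sum_prod_type, kroneckerMap_apply, norm_mul, mul_pow,
    Finset.sum_mul_sum]

variable [DecidableEq n] [Fintype n']

/-- If `Φ` contracts the traceless part of every matrix at least as much as it contracts that of
some state, then `ν₂` is multiplicative on `Φ ⊗ Ω` for every channel `Ω`. -/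
theorem nu2_tensorMap_of_norm_sq_le (Φ : Matrix n n ℂ →ₗ[ℂ] Matrix n' n' ℂ) {μ : ℝ}
    (hμ0 : 0 ≤ μ) (hμ1 : μ ≤ 1)
    (hΦ : ∀ A, ‖Φ A‖ ^ 2 ≤ μ ^ 2 * ‖A‖ ^ 2 + (1 - μ ^ 2) / Fintype.card n * ‖A.trace‖ ^ 2)
    {P : Matrix n n ℂ} (hP : IsDensity P)
    (hΦP : ‖Φ P‖ ^ 2 = μ ^ 2 + (1 - μ ^ 2) / Fintype.card n) (hΩ : IsChannel Ω) :
    nu2 (tensorMap Φ Ω) = nu2 Φ * nu2 Ω := by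
  have hc : 0 ≤ (1 - μ ^ 2) / Fintype.card n :=
    div_nonneg (sub_nonneg.2 (pow_le_one₀ hμ0 hμ1)) (Nat.cast_nonneg _)
  have : Nonempty {γ : Matrix n n ℂ // IsDensity γ} := ⟨⟨P, hP⟩⟩
  have hΦle : ∀ γ : {γ : Matrix n n ℂ // IsDensity γ}, hsNorm (Φ γ.1) ≤ ‖Φ P‖ := fun γ => by
    rw [hsNorm_eq_frobenius_norm]
    refine le_of_sq_le_sq ?_ (norm_nonneg _)
    rw [hΦP]
    refine (hΦ _).trans ?_
    have h1 := γ.2.1.frobenius_norm_le_trace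
    rw [γ.2.2, Complex.one_re] at h1
    rw [γ.2.2, norm_one, one_pow, mul_one]
    nlinarith [mul_le_mul_of_nonneg_left (pow_le_one₀ (norm_nonneg _) h1 (n := 2)) (sq_nonneg μ)]
  have hΦnu : nu2 Φ = ‖Φ P‖ := by
    refine le_antisymm (ciSup_le hΦle) ?_
    have := le_ciSup (f := fun γ : {γ : Matrix n n ℂ // IsDensity γ} => hsNorm (Φ γ.1))
      ⟨‖Φ P‖, by rintro _ ⟨γ, rfl⟩; exact hΦle γ⟩ ⟨P, hP⟩
    rwa [hsNorm_eq_frobenius_norm] at this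
  have hle : ∀ ρ : {ρ : Matrix (n × a) (n × a) ℂ // IsDensity ρ},
      hsNorm (tensorMap Φ Ω ρ.1) ≤ ‖Φ P‖ * nu2 Ω := by
    rintro ⟨ρ, hρ⟩
    let Y : b → b → Matrix n n ℂ := fun k l =>
      Matrix.of fun i j => Ω (Matrix.of fun k' l' => ρ (i, k') (j, l')) k l
    have h1 : ‖tensorMap Φ Ω ρ‖ ^ 2 = ∑ k, ∑ l, ‖Φ (Y k l)‖ ^ 2 := by
      simp only [frobenius_norm_sq, Fintype.sum_prod_type, tensorMap_apply]
      exact sum_sum_sum_sum_comm _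
    have h2 : ∑ k, ∑ l, ‖Y k l‖ ^ 2 ≤ nu2 Ω ^ 2 := by
      have := pow_le_pow_left₀ (norm_nonneg _) (hΩ.norm_blocks_le_nu2 hρ) 2
      refine le_trans (le_of_eq ?_) this
      simp only [frobenius_norm_sq, Fintype.sum_prod_type, Y, of_apply]
      exact (sum_sum_sum_sum_comm _).symm
    -- The traces of the `Y k l` are the entries of `Ω` applied to the partial trace of `ρ`, itself
    -- a density matrix.
    have h3 : ∑ k, ∑ l, ‖(Y k l).trace‖ ^ 2 ≤ nu2 Ω ^ 2 := by
      have hps : (∑ i, (Matrix.of fun k l => ρ (i, k) (i, l) : Matrix a a ℂ)).PosSemidef :=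
        Matrix.posSemidef_sum _ fun i _ => hρ.1.submatrix (fun k : a => (i, k))
      have htr : (∑ i, (Matrix.of fun k l => ρ (i, k) (i, l) : Matrix a a ℂ)).trace = 1 := by
        have := hρ.2
        rw [Matrix.trace_sum]
        simpa [Matrix.trace, Fintype.sum_prod_type] using this
      have := hΩ.norm_le_nu2_mul_trace hps
      rw [htr, Complex.one_re, mul_one] at this
      refine le_trans (le_of_eq ?_) (pow_le_pow_left₀ (norm_nonneg _) this 2)
      rw [frobenius_norm_sq]
      simp [Y, Matrix.trace, Matrix.sum_apply]
    rw [hsNorm_eq_frobenius_norm]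
    refine le_of_sq_le_sq ?_ (mul_nonneg (norm_nonneg _) (nu2_nonneg _))
    calc ‖tensorMap Φ Ω ρ‖ ^ 2
        ≤ ∑ k, ∑ l, (μ ^ 2 * ‖Y k l‖ ^ 2
            + (1 - μ ^ 2) / Fintype.card n * ‖(Y k l).trace‖ ^ 2) := by
          rw [h1]
          exact Finset.sum_le_sum fun k _ => Finset.sum_le_sum fun l _ => hΦ _
      _ = μ ^ 2 * ∑ k, ∑ l, ‖Y k l‖ ^ 2
            + (1 - μ ^ 2) / Fintype.card n * ∑ k, ∑ l, ‖(Y k l).trace‖ ^ 2 := by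
          simp only [Finset.sum_add_distrib, Finset.mul_sum]
      _ ≤ μ ^ 2 * nu2 Ω ^ 2 + (1 - μ ^ 2) / Fintype.card n * nu2 Ω ^ 2 :=
          add_le_add (mul_le_mul_of_nonneg_left h2 (sq_nonneg _))
            (mul_le_mul_of_nonneg_left h3 hc)
      _ = (‖Φ P‖ * nu2 Ω) ^ 2 := by rw [mul_pow, hΦP]; ring
  rw [hΦnu]
  -- `Real.iSup_le` needs only a nonnegative bound, so an empty index type `a` is covered too.
  refine le_antisymm (Real.iSup_le hle (mul_nonneg (norm_nonneg _) (nu2_nonneg _))) ?_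
  rw [nu2, Real.mul_iSup_of_nonneg (norm_nonneg _)]
  refine Real.iSup_le (fun γ => ?_) (nu2_nonneg _)
  have hd : IsDensity (P ⊗ₖ γ.1) :=
    ⟨hP.1.kronecker γ.2.1, by rw [trace_kronecker, hP.2, γ.2.2, mul_one]⟩
  have h := le_ciSup (f := fun ρ : {ρ : Matrix (n × a) (n × a) ℂ // IsDensity ρ} =>
    hsNorm (tensorMap Φ Ω ρ.1)) ⟨_, by rintro _ ⟨ρ, rfl⟩; exact hle ρ⟩ ⟨_, hd⟩
  rw [hsNorm_eq_frobenius_norm, tensorMap_kronecker, frobenius_norm_kronecker] at h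
  rwa [hsNorm_eq_frobenius_norm]

end Multiplicativity

/-! ### Mutually unbiased bases and channels constant on axes. -/

section Axes

open scoped Matrix.Norms.Frobenius

variable {ι n : Type*} [Fintype ι] [Fintype n]

/-- The rank-one matrix `|v⟩⟨v|`. -/
def rankOne (v : EuclideanSpace ℂ n) : Matrix n n ℂ := vecMulVec v.ofLp (star v.ofLp)

theorem trace_rankOne_mul (v : EuclideanSpace ℂ n) (A : Matrix n n ℂ) :
    (rankOne v * A).trace = star v.ofLp ⬝ᵥ (A *ᵥ v.ofLp) := by
  rw [rankOne, vecMulVec_mul, trace_vecMulVec, dotProduct_mulVec, dotProduct_comm]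

theorem trace_rankOne_mul_rankOne (u v : EuclideanSpace ℂ n) :
    (rankOne u * rankOne v).trace = ((‖inner ℂ u v‖ ^ 2 : ℝ) : ℂ) := by
  rw [trace_rankOne_mul, rankOne, vecMulVec_mulVec]
  have h : inner ℂ u v = star u.ofLp ⬝ᵥ v.ofLp := by
    rw [EuclideanSpace.inner_eq_star_dotProduct, dotProduct_comm]
  have h' : star v.ofLp ⬝ᵥ u.ofLp = star (inner ℂ u v) := by
    rw [h, star_dotProduct]
  rw [h', dotProduct_smul, ← h]
  push_cast
  rw [← Complex.mul_conj']
  rfl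

theorem conjTranspose_rankOne {n : Type*} (v : EuclideanSpace ℂ n) : (rankOne v)ᴴ = rankOne v := by
  rw [rankOne, conjTranspose_vecMulVec, star_star]

theorem trace_rankOne (v : EuclideanSpace ℂ n) : (rankOne v).trace = ((‖v‖ ^ 2 : ℝ) : ℂ) := by
  rw [rankOne, trace_vecMulVec, ← EuclideanSpace.inner_eq_star_dotProduct,
    inner_self_eq_norm_sq_to_K]
  simp

theorem isDensity_rankOne {v : EuclideanSpace ℂ n} (hv : ‖v‖ = 1) : IsDensity (rankOne v) :=
  ⟨posSemidef_vecMulVec_self_star _, by rw [trace_rankOne, hv]; simp⟩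

theorem sum_rankOne [DecidableEq n] (ψ : OrthonormalBasis ι ℂ (EuclideanSpace ℂ n)) :
    ∑ k, rankOne (ψ k) = 1 := by
  ext i j
  have h := ψ.sum_inner_mul_inner (EuclideanSpace.single i 1) (EuclideanSpace.single j 1)
  simp only [EuclideanSpace.inner_single_left, EuclideanSpace.inner_single_right] at h
  simp only [Matrix.sum_apply, rankOne, vecMulVec_apply, Matrix.one_apply]
  simpa [Pi.single_apply, eq_comm] using h

theorem qcChannel_apply (ψ : OrthonormalBasis ι ℂ (EuclideanSpace ℂ n)) (A : Matrix n n ℂ) :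
    qcChannel ψ A = ∑ k, (rankOne (ψ k) * A).trace • rankOne (ψ k) := by
  simp only [trace_rankOne_mul]
  rfl

theorem trace_rankOne_mul_rankOne_of_orthonormalBasis [DecidableEq ι]
    (ψ : OrthonormalBasis ι ℂ (EuclideanSpace ℂ n)) (j k : ι) :
    (rankOne (ψ j) * rankOne (ψ k)).trace = if j = k then 1 else 0 := by
  rw [trace_rankOne_mul_rankOne, OrthonormalBasis.inner_eq_ite]
  split_ifs <;> simp

theorem qcChannel_rankOne (ψ : OrthonormalBasis ι ℂ (EuclideanSpace ℂ n)) (k : ι) :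
    qcChannel ψ (rankOne (ψ k)) = rankOne (ψ k) := by
  classical
  rw [qcChannel_apply]
  simp [trace_rankOne_mul_rankOne_of_orthonormalBasis]

theorem qcChannel_one [DecidableEq n] (ψ : OrthonormalBasis ι ℂ (EuclideanSpace ℂ n)) :
    qcChannel ψ 1 = 1 := by
  rw [← sum_rankOne ψ, map_sum]
  simp only [qcChannel_rankOne]

theorem qcChannel_qcChannel (ψ : OrthonormalBasis ι ℂ (EuclideanSpace ℂ n))
    (A : Matrix n n ℂ) : qcChannel ψ (qcChannel ψ A) = qcChannel ψ A := by
  rw [qcChannel_apply ψ A, map_sum]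
  simp only [map_smul, qcChannel_rankOne]

theorem sum_trace_rankOne_mul (ψ : OrthonormalBasis ι ℂ (EuclideanSpace ℂ n))
    (A : Matrix n n ℂ) : ∑ k, (rankOne (ψ k) * A).trace = A.trace := by
  classical
  rw [← trace_sum, ← Finset.sum_mul, sum_rankOne, one_mul]

theorem trace_qcChannel (ψ : OrthonormalBasis ι ℂ (EuclideanSpace ℂ n)) (A : Matrix n n ℂ) :
    (qcChannel ψ A).trace = A.trace := by
  rw [qcChannel_apply, trace_sum]
  simp only [trace_smul, trace_rankOne, ψ.orthonormal.norm_eq_one]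
  simpa using sum_trace_rankOne_mul ψ A

/-- Self-adjointness: it reduces orthogonality of two axis components to the composition of their QC
channels. -/
theorem trace_conjTranspose_qcChannel_mul (ψ : OrthonormalBasis ι ℂ (EuclideanSpace ℂ n))
    (A B : Matrix n n ℂ) : ((qcChannel ψ A)ᴴ * B).trace = (Aᴴ * qcChannel ψ B).trace := by
  rw [qcChannel_apply, qcChannel_apply, conjTranspose_sum, Finset.sum_mul, Finset.mul_sum,
    trace_sum, trace_sum]
  refine Finset.sum_congr rfl fun k _ => ?_
  rw [conjTranspose_smul, conjTranspose_rankOne, Matrix.smul_mul, Matrix.mul_smul, trace_smul,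
    trace_smul, ← trace_conjTranspose, conjTranspose_mul, conjTranspose_rankOne, smul_eq_mul,
    smul_eq_mul, mul_comm]

theorem trace_linearMap_qcChannel (ψ : OrthonormalBasis ι ℂ (EuclideanSpace ℂ n)) :
    LinearMap.trace ℂ _ (qcChannel ψ) = Fintype.card ι := by
  classical
  have h : qcChannel ψ = ∑ k, ((Matrix.traceLinearMap n ℂ ℂ).comp
      (LinearMap.mulLeft ℂ (rankOne (ψ k)))).smulRight (rankOne (ψ k)) := by
    refine LinearMap.ext fun A => ?_
    rw [qcChannel_apply, LinearMap.sum_apply]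
    rfl
  rw [h, map_sum]
  have h1 : ∀ k, (rankOne (ψ k) * rankOne (ψ k)).trace = 1 := fun k => by
    simp [trace_rankOne_mul_rankOne_of_orthonormalBasis]
  simp [LinearMap.trace_smulRight, h1]

theorem frobenius_norm_sq_sum_smul_of_orthogonal {v : ι → Matrix n n ℂ}
    (hv : ∀ j k, j ≠ k → ((v j)ᴴ * v k).trace = 0) (c : ι → ℝ) :
    ‖∑ k, (c k : ℂ) • v k‖ ^ 2 = ∑ k, c k ^ 2 * ‖v k‖ ^ 2 := by
  classical
  apply Complex.ofReal_injective
  rw [← trace_conjTranspose_mul_self_re, conjTranspose_sum, Finset.sum_mul_sum, trace_sum]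
  push_cast
  refine Finset.sum_congr rfl fun j _ => ?_
  rw [trace_sum, Finset.sum_eq_single j]
  · rw [conjTranspose_smul, Matrix.smul_mul, Matrix.mul_smul, trace_smul, trace_smul,
      trace_conjTranspose_mul_self_re]
    simp only [smul_eq_mul, RCLike.star_def, Complex.conj_ofReal]
    push_cast
    ring
  · intro k _ hk
    rw [conjTranspose_smul, Matrix.smul_mul, Matrix.mul_smul, trace_smul, trace_smul,
      hv j k hk.symm, smul_zero, smul_zero]
  · simp

variable {d : ℕ} {ψ : Fin (d + 1) → OrthonormalBasis (Fin d) ℂ (EuclideanSpace ℂ n)}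

/-- Each projection of one basis has constant diagonal `1/d` in the other. -/
theorem IsMUB.qcChannel_qcChannel [DecidableEq n] (hψ : IsMUB ψ) {J K : Fin (d + 1)}
    (h : J ≠ K) (A : Matrix n n ℂ) :
    qcChannel (ψ J) (qcChannel (ψ K) A) = (A.trace / d) • (1 : Matrix n n ℂ) := by
  have h1 : ∀ k, qcChannel (ψ J) (rankOne (ψ K k)) = (1 / d : ℂ) • (1 : Matrix n n ℂ) := by
    intro k
    rw [qcChannel_apply, ← sum_rankOne (ψ J), Finset.smul_sum]
    refine Finset.sum_congr rfl fun j _ => ?_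
    rw [trace_rankOne_mul_rankOne, hψ J K h]
    simp
  rw [qcChannel_apply (ψ K), map_sum]
  simp only [map_smul, h1, smul_smul]
  rw [← Finset.sum_smul, ← Finset.sum_mul, sum_trace_rankOne_mul, mul_one_div]

/-- A full set of mutually unbiased bases is complete: `∑_L Ψ_L^QC(A) = A + Tr(A) I`. -/
theorem IsMUB.sum_qcChannel [DecidableEq n] (hd : d ≠ 0) (hψ : IsMUB ψ) (A : Matrix n n ℂ) :
    ∑ L, qcChannel (ψ L) A = A + A.trace • (1 : Matrix n n ℂ) := by
  have hcard : Fintype.card n = d := by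
    have := Module.finrank_eq_card_basis (ψ 0).toBasis
    simpa using this
  have hd' : (d : ℂ) ≠ 0 := Nat.cast_ne_zero.2 hd
  -- The claim is `E = 1`. `E` is idempotent with operator trace `d(d+1) - d = d²`, so `1 - E` is an
  -- idempotent of trace zero.
  let E : Matrix n n ℂ →ₗ[ℂ] Matrix n n ℂ :=
    ∑ L, qcChannel (ψ L) - (Matrix.traceLinearMap n ℂ ℂ).smulRight 1
  have hE : ∀ B, E B = ∑ L, qcChannel (ψ L) B - B.trace • (1 : Matrix n n ℂ) := fun B => by
    simp [E, LinearMap.sum_apply]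
  have htr : ∀ B, (E B).trace = B.trace := fun B => by
    rw [hE, trace_sub, trace_sum]
    simp only [trace_qcChannel, trace_smul, trace_one, hcard]
    simp
    ring
  -- Axis `L` reproduces itself; the `d` other axes give `(Tr B / d) I` each, cancelling the
  -- subtracted `Tr(B) I`.
  have hqc : ∀ L B, qcChannel (ψ L) (E B) = qcChannel (ψ L) B := fun L B => by
    rw [hE, map_sub, map_sum, map_smul, qcChannel_one, Fin.sum_univ_succAbove _ L,
      _root_.qcChannel_qcChannel]
    rw [Finset.sum_congr rfl fun K _ => hψ.qcChannel_qcChannel (Fin.succAbove_ne L K).symm B]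
    rw [Finset.sum_const, Finset.card_univ, Fintype.card_fin, ← Nat.cast_smul_eq_nsmul ℂ,
      smul_smul, mul_div_cancel₀ _ hd', add_sub_cancel_right]
  have hidem : IsIdempotentElem E := by
    refine LinearMap.ext fun B => ?_
    rw [Module.End.mul_apply, hE (E B), htr]
    simp only [hqc]
    exact (hE B).symm
  have htrace : LinearMap.trace ℂ _ (1 - E) = 0 := by
    simp only [E, map_sub, map_sum, trace_linearMap_qcChannel, LinearMap.trace_smulRight,
      LinearMap.trace_one]
    simp [hcard, Module.finrank_matrix]
    ring
  have h0 := (LinearMap.IsIdempotentElem.trace_eq_zero_iff hidem.one_sub).1 htrace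
  have h1 : E A = A := by
    have := LinearMap.congr_fun (sub_eq_zero.1 h0) A
    exact this.symm
  rw [hE] at h1
  exact sub_eq_iff_eq_add.1 h1

theorem IsConstantOnAxes.trace_map {Ψ : Matrix n n ℂ →ₗ[ℂ] Matrix n n ℂ}
    {lam : Fin (d + 1) → ℝ} (h : IsConstantOnAxes ψ Ψ lam) (A : Matrix n n ℂ) :
    (Ψ A).trace = A.trace := by
  obtain ⟨-, s, t, hst, -, -, rfl, -⟩ := h
  have hst' : (s : ℂ) + ∑ L, (t L : ℂ) = 1 := by exact_mod_cast hst
  simp only [LinearMap.add_apply, LinearMap.smul_apply, LinearMap.sum_apply, LinearMap.id_apply,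
    trace_add, trace_smul, trace_sum, trace_qcChannel, smul_eq_mul]
  rw [← Finset.sum_mul, ← add_mul, hst', one_mul]

theorem IsConstantOnAxes.map_one [DecidableEq n] {Ψ : Matrix n n ℂ →ₗ[ℂ] Matrix n n ℂ}
    {lam : Fin (d + 1) → ℝ} (h : IsConstantOnAxes ψ Ψ lam) : Ψ 1 = 1 := by
  obtain ⟨-, s, t, hst, -, -, rfl, -⟩ := h
  have hst' : (s : ℂ) + ∑ L, (t L : ℂ) = 1 := by exact_mod_cast hst
  simp only [LinearMap.add_apply, LinearMap.smul_apply, LinearMap.sum_apply, LinearMap.id_apply,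
    qcChannel_one]
  rw [← Finset.sum_smul, ← add_smul, hst', one_smul]

/-- Completeness distributes `s A` over the axes, turning `t_L` into `s + t_L`. -/
theorem IsConstantOnAxes.map_eq_sum_of_trace_eq_zero (hd : d ≠ 0)
    {Ψ : Matrix n n ℂ →ₗ[ℂ] Matrix n n ℂ} {lam : Fin (d + 1) → ℝ}
    (h : IsConstantOnAxes ψ Ψ lam) {A : Matrix n n ℂ} (hA : A.trace = 0) :
    Ψ A = ∑ L, (lam L : ℂ) • qcChannel (ψ L) A := by
  classical
  obtain ⟨hψ, s, t, -, -, -, rfl, hlam⟩ := h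
  have hsum := hψ.sum_qcChannel hd A
  rw [hA, zero_smul, add_zero] at hsum
  simp only [LinearMap.add_apply, LinearMap.smul_apply, LinearMap.sum_apply, LinearMap.id_apply,
    hlam, Complex.ofReal_add, add_smul, Finset.sum_add_distrib]
  rw [← Finset.smul_sum, hsum]

theorem IsConstantOnAxes.norm_le_of_trace_eq_zero (hd : d ≠ 0)
    {Ψ : Matrix n n ℂ →ₗ[ℂ] Matrix n n ℂ} {lam : Fin (d + 1) → ℝ}
    (h : IsConstantOnAxes ψ Ψ lam) {μ : ℝ} (hμ : ∀ L, |lam L| ≤ μ) {A : Matrix n n ℂ}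
    (hA : A.trace = 0) : ‖Ψ A‖ ≤ μ * ‖A‖ := by
  classical
  have hμ0 : 0 ≤ μ := (abs_nonneg _).trans (hμ 0)
  have hψ := h.1
  have horth : ∀ J K, J ≠ K →
      ((qcChannel (ψ J) A)ᴴ * qcChannel (ψ K) A).trace = 0 := fun J K hJK => by
    rw [trace_conjTranspose_qcChannel_mul, hψ.qcChannel_qcChannel hJK, hA]
    simp
  have hsum := hψ.sum_qcChannel hd A
  rw [hA, zero_smul, add_zero] at hsum
  -- Unit coefficients give Pythagoras for `A` itself, to compare with the coefficients `lam L`.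
  have hnorm := frobenius_norm_sq_sum_smul_of_orthogonal horth (fun _ => 1)
  simp only [Complex.ofReal_one, one_smul, hsum, one_pow, one_mul] at hnorm
  refine le_of_sq_le_sq ?_ (mul_nonneg hμ0 (norm_nonneg _))
  rw [h.map_eq_sum_of_trace_eq_zero hd hA, frobenius_norm_sq_sum_smul_of_orthogonal horth,
    mul_pow, hnorm, Finset.mul_sum]
  exact Finset.sum_le_sum fun L _ => mul_le_mul_of_nonneg_right
    (sq_le_sq' (neg_le_of_abs_le (hμ L)) (le_of_abs_le (hμ L))) (sq_nonneg _)

theorem IsConstantOnAxes.lam_le_one {Ψ : Matrix n n ℂ →ₗ[ℂ] Matrix n n ℂ}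
    {lam : Fin (d + 1) → ℝ} (h : IsConstantOnAxes ψ Ψ lam) (L : Fin (d + 1)) : lam L ≤ 1 := by
  obtain ⟨-, s, t, hst, ht, -, -, hlam⟩ := h
  rw [hlam, ← hst]
  exact add_le_add_right (Finset.single_le_sum (fun K _ => ht K) (Finset.mem_univ L)) s

theorem IsConstantOnAxes.map_rankOne [DecidableEq n]
    {Ψ : Matrix n n ℂ →ₗ[ℂ] Matrix n n ℂ} {lam : Fin (d + 1) → ℝ}
    (h : IsConstantOnAxes ψ Ψ lam) (L : Fin (d + 1)) (k : Fin d) :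
    Ψ (rankOne (ψ L k)) =
      (lam L : ℂ) • rankOne (ψ L k) + ((1 - lam L) / d : ℂ) • (1 : Matrix n n ℂ) := by
  obtain ⟨hψ, s, t, hst, -, -, rfl, hlam⟩ := h
  have htr : (rankOne (ψ L k)).trace = 1 := by
    simp [trace_rankOne, (ψ L).orthonormal.norm_eq_one]
  have hK : ∀ K, K ≠ L → qcChannel (ψ K) (rankOne (ψ L k)) = (1 / d : ℂ) • 1 := fun K hK => by
    rw [← qcChannel_rankOne, hψ.qcChannel_qcChannel hK, htr]
  have hst' : (s : ℂ) + ∑ K, (t K : ℂ) = 1 := by exact_mod_cast hst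
  rw [Fin.sum_univ_succAbove _ L] at hst'
  simp only [LinearMap.add_apply, LinearMap.smul_apply, LinearMap.sum_apply, LinearMap.id_apply]
  rw [Fin.sum_univ_succAbove _ L, qcChannel_rankOne,
    Finset.sum_congr rfl fun K _ => by rw [hK _ (Fin.succAbove_ne L K), smul_smul],
    ← Finset.sum_smul, ← Finset.sum_mul, hlam, ← add_assoc, ← add_smul, ← Complex.ofReal_add]
  congr 2
  push_cast
  linear_combination (1 / d : ℂ) * hst'

end Axes

/-! ### Unitarity of the Pauli products. -/

section Pauli

theorem conjTranspose_pauliX_mul_self (p : ℕ) [NeZero p] : (pauliX p)ᴴ * pauliX p = 1 := by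
  ext i j
  rw [Matrix.mul_apply, Finset.sum_eq_single (i + 1)]
  · simp [pauliX, Matrix.one_apply]
  · intro k _ hk
    simp [pauliX, hk]
  · simp

theorem conjTranspose_pauliZ_mul_self (p : ℕ) [NeZero p] : (pauliZ p)ᴴ * pauliZ p = 1 := by
  rw [pauliZ, diagonal_conjTranspose, diagonal_mul_diagonal, ← diagonal_one]
  congr 1
  ext k
  have h : ‖Complex.exp (2 * Real.pi * Complex.I / p)‖ = 1 := by
    have : (2 * Real.pi * Complex.I / p : ℂ) = ((2 * Real.pi / p : ℝ) : ℂ) * Complex.I := by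
      push_cast
      ring
    rw [this, Complex.norm_exp_ofReal_mul_I]
  simp [Complex.conj_mul', h, ← mul_pow]

theorem conjTranspose_pauliTensor_mul_self {p m : ℕ} [NeZero p]
    (v : (Fin m → ZMod p) × (Fin m → ZMod p)) :
    (pauliTensor v)ᴴ * pauliTensor v = 1 := by
  let W : Fin m → Matrix (ZMod p) (ZMod p) ℂ := fun i =>
    pauliX p ^ (v.1 i).val * pauliZ p ^ (v.2 i).val
  have hW : ∀ i, (W i)ᴴ * W i = 1 := fun i => by
    have hX : pauliX p ∈ unitaryGroup (ZMod p) ℂ :=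
      mem_unitaryGroup_iff'.2 (conjTranspose_pauliX_mul_self p)
    have hZ : pauliZ p ∈ unitaryGroup (ZMod p) ℂ :=
      mem_unitaryGroup_iff'.2 (conjTranspose_pauliZ_mul_self p)
    exact mem_unitaryGroup_iff'.1 (mul_mem (pow_mem hX _) (pow_mem hZ _))
  ext r c
  -- The sum over functions `s` factors into a product of one-site sums.
  have h : ((pauliTensor v)ᴴ * pauliTensor v) r c = ∏ i, ((W i)ᴴ * W i) (r i) (c i) := by
    simp only [Matrix.mul_apply, conjTranspose_apply]
    rw [Finset.prod_univ_sum, Fintype.piFinset_univ]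
    refine Finset.sum_congr rfl fun s _ => ?_
    rw [Finset.prod_mul_distrib, ← star_prod]
    rfl
  rw [h]
  simp only [hW, Matrix.one_apply, Finset.prod_ite_zero, Finset.prod_const_one, funext_iff,
    Finset.mem_univ, true_implies]

theorem IsPauliPartition.conjTranspose_mul_self {p m : ℕ} [NeZero p]
    {U : Fin (p ^ m + 1) → Fin (p ^ m - 1) → Matrix (Fin m → ZMod p) (Fin m → ZMod p) ℂ}
    (hU : IsPauliPartition U) (L : Fin (p ^ m + 1)) (j : Fin (p ^ m - 1)) :
    (U L j)ᴴ * U L j = 1 := by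
  obtain ⟨e, he⟩ := hU.exists_labels
  obtain ⟨z, hz, hUz⟩ := he L j
  rw [hUz, conjTranspose_smul, Matrix.smul_mul, Matrix.mul_smul,
    conjTranspose_pauliTensor_mul_self, smul_smul]
  simp [Complex.conj_mul', hz]

end Pauli

/-! ### Convex combinations of unitary conjugations. -/

section Conjugation

open scoped Matrix.Norms.Frobenius

variable {κ n : Type*} [Fintype κ] [Fintype n]

variable {V : κ → Matrix n n ℂ} {M : Matrix n n ℂ →ₗ[ℂ] Matrix n n ℂ}

theorem IsAxisConjugation.map_eq_self (hM : IsAxisConjugation V M) {A : Matrix n n ℂ}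
    (hA : ∀ j, conjMap (V j) A = A) : M A = A := by
  obtain ⟨c₀, c, -, -, hc, rfl⟩ := hM
  have hc' : (c₀ : ℂ) + ∑ j, (c j : ℂ) = 1 := by exact_mod_cast hc
  simp only [LinearMap.add_apply, LinearMap.smul_apply, LinearMap.sum_apply, LinearMap.id_apply,
    hA]
  rw [← Finset.sum_smul, ← add_smul, hc', one_smul]

variable [DecidableEq n]

theorem trace_conjMap {V : Matrix n n ℂ} (hV : Vᴴ * V = 1) (A : Matrix n n ℂ) :
    (conjMap V A).trace = A.trace := by
  change (V * A * Vᴴ).trace = _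
  rw [trace_mul_comm, ← Matrix.mul_assoc, hV, Matrix.one_mul]

theorem norm_conjMap {V : Matrix n n ℂ} (hV : Vᴴ * V = 1) (A : Matrix n n ℂ) :
    ‖conjMap V A‖ = ‖A‖ := by
  refine (sq_eq_sq₀ (norm_nonneg _) (norm_nonneg _)).1 (Complex.ofReal_injective ?_)
  rw [← trace_conjTranspose_mul_self_re, ← trace_conjTranspose_mul_self_re,
    ← trace_conjMap hV (Aᴴ * A)]
  change ((V * A * Vᴴ)ᴴ * (V * A * Vᴴ)).trace = (V * (Aᴴ * A) * Vᴴ).trace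
  simp only [conjTranspose_mul, conjTranspose_conjTranspose, Matrix.mul_assoc]
  rw [← Matrix.mul_assoc Vᴴ V, hV, Matrix.one_mul]

theorem conjMap_rankOne {V : Matrix n n ℂ} (hV : Vᴴ * V = 1) {v : EuclideanSpace ℂ n}
    (hv : ‖v‖ = 1) {z : ℂ} (hz : V *ᵥ v.ofLp = z • v.ofLp) :
    conjMap V (rankOne v) = rankOne v := by
  have h : conjMap V (rankOne v) = (z * star z) • rankOne v := by
    change V * rankOne v * Vᴴ = _
    rw [rankOne, mul_vecMulVec, vecMulVec_mul, ← star_mulVec, hz, star_smul, smul_vecMulVec,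
      vecMulVec_smul, smul_smul]
  -- Trace preservation forces the eigenvalue to have modulus one.
  have htr := trace_conjMap hV (rankOne v)
  rw [h, trace_smul, trace_rankOne, hv] at htr
  have hz1 : z * star z = 1 := by simpa using htr
  rw [h, hz1, one_smul]

theorem IsAxisConjugation.map_one (hM : IsAxisConjugation V M) (hV : ∀ j, (V j)ᴴ * V j = 1) :
    M 1 = 1 :=
  hM.map_eq_self fun j => by
    change V j * 1 * (V j)ᴴ = 1
    rw [Matrix.mul_one, mul_eq_one_comm.1 (hV j)]

theorem IsAxisConjugation.trace_map (hM : IsAxisConjugation V M)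
    (hV : ∀ j, (V j)ᴴ * V j = 1) (A : Matrix n n ℂ) : (M A).trace = A.trace := by
  obtain ⟨c₀, c, -, -, hc, rfl⟩ := hM
  have hc' : (c₀ : ℂ) + ∑ j, (c j : ℂ) = 1 := by exact_mod_cast hc
  simp only [LinearMap.add_apply, LinearMap.smul_apply, LinearMap.sum_apply, LinearMap.id_apply,
    trace_add, trace_smul, trace_sum, trace_conjMap (hV _), smul_eq_mul]
  rw [← Finset.sum_mul, ← add_mul, hc', one_mul]

theorem IsAxisConjugation.norm_le (hM : IsAxisConjugation V M)
    (hV : ∀ j, (V j)ᴴ * V j = 1) (A : Matrix n n ℂ) : ‖M A‖ ≤ ‖A‖ := by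
  obtain ⟨c₀, c, hc₀, hc0, hc, rfl⟩ := hM
  simp only [LinearMap.add_apply, LinearMap.smul_apply, LinearMap.sum_apply, LinearMap.id_apply]
  calc ‖(c₀ : ℂ) • A + ∑ j, (c j : ℂ) • conjMap (V j) A‖
      ≤ ‖(c₀ : ℂ) • A‖ + ∑ j, ‖(c j : ℂ) • conjMap (V j) A‖ :=
        (norm_add_le _ _).trans (add_le_add_right (norm_sum_le _ _) _)
    _ = (c₀ + ∑ j, c j) * ‖A‖ := by
        simp only [norm_smul, norm_conjMap (hV _), Complex.norm_real, Real.norm_eq_abs,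
          abs_of_nonneg hc₀, abs_of_nonneg (hc0 _)]
        rw [add_mul, Finset.sum_mul]
    _ = ‖A‖ := by rw [hc, one_mul]

end Conjugation

/-! ### From contraction on traceless matrices to the quadratic bound. -/

section Unital

open scoped Matrix.Norms.Frobenius

variable {n a b : Type*} [Fintype n] [DecidableEq n] [Fintype a] [DecidableEq a] [Fintype b]

theorem frobenius_norm_sq_add_smul_one {A : Matrix n n ℂ} (hA : A.trace = 0) (c : ℂ) :
    ‖A + c • (1 : Matrix n n ℂ)‖ ^ 2 = ‖A‖ ^ 2 + ‖c‖ ^ 2 * Fintype.card n := by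
  apply Complex.ofReal_injective
  rw [← trace_conjTranspose_mul_self_re]
  simp only [conjTranspose_add, conjTranspose_smul, conjTranspose_one, Matrix.add_mul,
    Matrix.mul_add, Matrix.smul_mul, Matrix.mul_smul, Matrix.one_mul, Matrix.mul_one, trace_add,
    trace_smul, trace_conjTranspose, hA, trace_one, trace_conjTranspose_mul_self_re]
  push_cast
  rw [← Complex.conj_mul']
  simp
  ring

variable [Nonempty n]

theorem frobenius_norm_sq_eq_traceless_add (A : Matrix n n ℂ) :
    ‖A‖ ^ 2 = ‖A - (A.trace / Fintype.card n) • (1 : Matrix n n ℂ)‖ ^ 2 +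
      ‖A.trace‖ ^ 2 / Fintype.card n := by
  have hn : (Fintype.card n : ℂ) ≠ 0 := Nat.cast_ne_zero.2 Fintype.card_ne_zero
  have hn' : (Fintype.card n : ℝ) ≠ 0 := Nat.cast_ne_zero.2 Fintype.card_ne_zero
  have h := frobenius_norm_sq_add_smul_one
    (A := A - (A.trace / Fintype.card n) • (1 : Matrix n n ℂ))
    (by rw [trace_sub, trace_smul, trace_one, smul_eq_mul, div_mul_cancel₀ _ hn, sub_self])
    (A.trace / Fintype.card n)
  rw [sub_add_cancel] at h
  rw [h, norm_div, Complex.norm_natCast]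
  field_simp

/-- Multiplicativity of `ν₂` for a unital trace-preserving map whose strongest action on
traceless matrices, contraction by `μ`, is attained on a pure state. -/
theorem nu2_tensorMap_of_unital {Φ : Matrix n n ℂ →ₗ[ℂ] Matrix n n ℂ} {μ : ℝ}
    (hμ0 : 0 ≤ μ) (hμ1 : μ ≤ 1) (hone : Φ 1 = 1) (htr : ∀ A, (Φ A).trace = A.trace)
    (hΦ : ∀ A, A.trace = 0 → ‖Φ A‖ ≤ μ * ‖A‖) {v : EuclideanSpace ℂ n} (hv : ‖v‖ = 1)
    (hΦv : Φ (rankOne v) =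
      (μ : ℂ) • rankOne v + ((1 - μ) / Fintype.card n : ℂ) • (1 : Matrix n n ℂ))
    {Ω : Matrix a a ℂ →ₗ[ℂ] Matrix b b ℂ} (hΩ : IsChannel Ω) :
    nu2 (tensorMap Φ Ω) = nu2 Φ * nu2 Ω := by
  have hn : (Fintype.card n : ℂ) ≠ 0 := Nat.cast_ne_zero.2 Fintype.card_ne_zero
  have htrv : (rankOne v).trace = 1 := (isDensity_rankOne hv).2
  refine nu2_tensorMap_of_norm_sq_le Φ hμ0 hμ1 (fun A => ?_) (isDensity_rankOne hv) ?_ hΩ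
  · set A₀ := A - (A.trace / Fintype.card n) • (1 : Matrix n n ℂ) with hA₀
    have h0 : A₀.trace = 0 := by
      rw [hA₀, trace_sub, trace_smul, trace_one, smul_eq_mul, div_mul_cancel₀ _ hn, sub_self]
    -- Unitality and trace preservation make `Φ` commute with taking traceless parts.
    have h1 : Φ A - ((Φ A).trace / Fintype.card n) • (1 : Matrix n n ℂ) = Φ A₀ := by
      rw [hA₀, map_sub, map_smul, hone, htr]
    rw [frobenius_norm_sq_eq_traceless_add (Φ A), frobenius_norm_sq_eq_traceless_add A, h1, htr,
      ← hA₀]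
    have h2 := pow_le_pow_left₀ (norm_nonneg _) (hΦ A₀ h0) 2
    rw [mul_pow] at h2
    refine (add_le_add_left h2 _).trans_eq ?_
    ring
  · have h1 : ‖rankOne v‖ ^ 2 = 1 := by
      apply Complex.ofReal_injective
      rw [← trace_conjTranspose_mul_self_re, conjTranspose_rankOne, trace_rankOne_mul_rankOne,
        inner_self_eq_norm_sq_to_K, hv]
      simp
    rw [frobenius_norm_sq_eq_traceless_add, htrv] at h1
    have h2 : Φ (rankOne v) - ((Φ (rankOne v)).trace / Fintype.card n) • (1 : Matrix n n ℂ) =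
        (μ : ℂ) • (rankOne v - (1 / Fintype.card n : ℂ) • (1 : Matrix n n ℂ)) := by
      rw [htr, htrv, hΦv]
      module
    rw [frobenius_norm_sq_eq_traceless_add, h2, htr, htrv, norm_smul, mul_pow, Complex.norm_real,
      Real.norm_eq_abs, sq_abs, eq_sub_of_add_eq h1, norm_one]
    ring

end Unital

/-! ### The two families of channels. -/

section Main

open scoped Matrix.Norms.Frobenius

theorem mainTheorem10 {p m : ℕ} [Fact p.Prime] (hm : 1 ≤ m)
    (U : Fin (p ^ m + 1) → Fin (p ^ m - 1) → Matrix (Fin m → ZMod p) (Fin m → ZMod p) ℂ)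
    (hU : IsPauliPartition U)
    (ψ : Fin (p ^ m + 1) →
      OrthonormalBasis (Fin (p ^ m)) ℂ (EuclideanSpace ℂ (Fin m → ZMod p)))
    (hψ : IsSimultaneousEigenbases U ψ)
    (Ψ M : Matrix (Fin m → ZMod p) (Fin m → ZMod p) ℂ →ₗ[ℂ]
      Matrix (Fin m → ZMod p) (Fin m → ZMod p) ℂ)
    (lam : Fin (p ^ m + 1) → ℝ) (hΨ : IsConstantOnAxes ψ Ψ lam)
    (L₀ : Fin (p ^ m + 1)) (hL₀ : ∀ L, |lam L| ≤ lam L₀)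
    (hM : IsAxisConjugation (U L₀) M)
    {a b : Type*} [Fintype a] [DecidableEq a] [Fintype b]
    (Ω : Matrix a a ℂ →ₗ[ℂ] Matrix b b ℂ) (hΩ : IsChannel Ω) :
    (∀ x : ℝ, 0 ≤ x → x ≤ 1 →
      nu2 (tensorMap ((x : ℂ) • M + ((1 - x : ℝ) : ℂ) • Ψ) Ω) =
        nu2 ((x : ℂ) • M + ((1 - x : ℝ) : ℂ) • Ψ) * nu2 Ω) ∧
    nu2 (tensorMap (Ψ ∘ₗ M) Ω) = nu2 (Ψ ∘ₗ M) * nu2 Ω := by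
  have hd : p ^ m ≠ 0 := pow_ne_zero _ (Fact.out : p.Prime).ne_zero
  have hcard : Fintype.card (Fin m → ZMod p) = p ^ m := by simp
  have hV := hU.conjTranspose_mul_self L₀
  let k₀ : Fin (p ^ m) := ⟨0, Nat.pos_of_ne_zero hd⟩
  have hv : ‖ψ L₀ k₀‖ = 1 := (ψ L₀).orthonormal.norm_eq_one k₀
  have hMv : M (rankOne (ψ L₀ k₀)) = rankOne (ψ L₀ k₀) := hM.map_eq_self fun j => by
    obtain ⟨z, hz⟩ := hψ L₀ j k₀
    exact conjMap_rankOne (hV j) hv hz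
  have hΨv : Ψ (rankOne (ψ L₀ k₀)) = (lam L₀ : ℂ) • rankOne (ψ L₀ k₀) +
      ((1 - lam L₀) / Fintype.card (Fin m → ZMod p) : ℂ) • 1 := by
    rw [hcard]
    exact hΨ.map_rankOne L₀ k₀
  have h0 : 0 ≤ lam L₀ := (abs_nonneg _).trans (hL₀ L₀)
  have h1 : lam L₀ ≤ 1 := hΨ.lam_le_one L₀
  have hΨn : ∀ A : Matrix (Fin m → ZMod p) (Fin m → ZMod p) ℂ, A.trace = 0 →
      ‖Ψ A‖ ≤ lam L₀ * ‖A‖ := fun A hA => hΨ.norm_le_of_trace_eq_zero hd hL₀ hA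
  refine ⟨fun x hx0 hx1 => ?_, ?_⟩
  · have hx1' : 0 ≤ 1 - x := sub_nonneg.2 hx1
    -- On the traceless part of the fixed projection `M` acts as 1 and `Ψ` as `lam L₀`, so `μ` is
    -- their average.
    refine nu2_tensorMap_of_unital (μ := x + (1 - x) * lam L₀) (v := ψ L₀ k₀)
      (by positivity) (by nlinarith) ?_ (fun A => ?_) (fun A hA => ?_) hv ?_ hΩ
    · rw [LinearMap.add_apply, LinearMap.smul_apply, LinearMap.smul_apply, hM.map_one hV,
        hΨ.map_one, ← add_smul, ← Complex.ofReal_add, add_sub_cancel, Complex.ofReal_one, one_smul]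
    · rw [LinearMap.add_apply, LinearMap.smul_apply, LinearMap.smul_apply, trace_add, trace_smul,
        trace_smul, hM.trace_map hV, hΨ.trace_map, ← add_smul, ← Complex.ofReal_add,
        add_sub_cancel, Complex.ofReal_one, one_smul]
    · rw [LinearMap.add_apply, LinearMap.smul_apply, LinearMap.smul_apply]
      refine (norm_add_le _ _).trans ?_
      rw [norm_smul, norm_smul, Complex.norm_real, Complex.norm_real, Real.norm_eq_abs,
        Real.norm_eq_abs, abs_of_nonneg hx0, abs_of_nonneg hx1', add_mul, mul_assoc]
      exact add_le_add (mul_le_mul_of_nonneg_left (hM.norm_le hV A) hx0)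
        (mul_le_mul_of_nonneg_left (hΨn A hA) hx1')
    · rw [LinearMap.add_apply, LinearMap.smul_apply, LinearMap.smul_apply, hMv, hΨv]
      push_cast
      module
  · refine nu2_tensorMap_of_unital h0 h1 (v := ψ L₀ k₀) ?_ (fun A => ?_) (fun A hA => ?_) hv ?_ hΩ
    · rw [LinearMap.comp_apply, hM.map_one hV, hΨ.map_one]
    · rw [LinearMap.comp_apply, hΨ.trace_map, hM.trace_map hV]
    · rw [LinearMap.comp_apply]
      exact (hΨn _ (by rw [hM.trace_map hV, hA])).trans
        (mul_le_mul_of_nonneg_left (hM.norm_le hV A) h0)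
    · rw [LinearMap.comp_apply, hMv, hΨv]

end Main
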